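/- Let $\mathbb C_+=\{s\in\mathbb C:\operatorname{Re}s>0\}$. Let $D_a(\mathbb C_+)$ be the complex vector space of all Dirichlet series $D=\sum_{n=1}^\infty a_n n^{-s}$ with complex coefficients that converge absolutely at every point of $\mathbb C_+$, equivalently such that $\|D\|_\sigma:=\sum_{n=1}^\infty |a_n|n^{-\sigma}<\infty$ for every $\sigma>0$, endowed with the topology induced by the seminorms $\|\cdot\|_\sigma$, $\sigma>0$. For $N\in\mathbb N$ write $S_ND(s)=\sum_{n=1}^N a_n n^{-s}$ for the partial sums of $D$. Call $D\in D_a(\mathbb C_+)$ universal if for every entire function $g$ there is a strictly increasing sequence $(\lambda_n)$ of natural numbers such that, for every $\ell\in\{0,1,2,\dots\}$, the derivatives $(S_{\lambda_n}D)^{(\ell)}$ converge to $g^{(\ell)}$ as $n\to\infty$, uniformly on each compact subset of the closed left half-plane $\{s\in\mathbb C:\operatorname{Re}s\le 0\}$. Then universal Dirichlet series exist; the set of universal Dirichlet series is a dense $G_\delta$ subset of $D_a(\mathbb C_+)$; and there is a dense vector subspace $V$ of $D_a(\mathbb C_+)$ such that every $D\in V\setminus\{0\}$ is universal. -/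

import Mathlib

open Filter Topology

noncomputable section

namespace DirichletSeries

/-- The coefficient sequences `a = (a₁, a₂, …)` of Dirichlet series `∑_{n ≥ 1} a_n n^{-s}` such that
`∑_{n ≥ 1} |a_n| n^{-σ} < ∞` for all `σ > 0`. The unused entry `a 0` is normalised to `0`. -/
def absConvSubmodule : Submodule ℂ (ℕ → ℂ) where
  carrier := {a | a 0 = 0 ∧ ∀ σ : ℝ, 0 < σ → Summable fun n : ℕ => ‖a n‖ * (n : ℝ) ^ (-σ)}
  zero_mem' := by
    refine ⟨rfl, fun σ _ => ?_⟩
    simp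
  add_mem' := by
    rintro a b ⟨ha0, ha⟩ ⟨hb0, hb⟩
    refine ⟨by simp [ha0, hb0], fun σ hσ => ?_⟩
    refine Summable.of_nonneg_of_le (fun n => by positivity) (fun n => ?_) ((ha σ hσ).add (hb σ hσ))
    rw [← add_mul]
    exact mul_le_mul_of_nonneg_right (norm_add_le _ _) (by positivity)
  smul_mem' := by
    rintro c a ⟨ha0, ha⟩
    refine ⟨by simp [ha0], fun σ hσ => ?_⟩
    simpa [mul_assoc] using (ha σ hσ).mul_left ‖c‖

/-- Membership means exactly that the Dirichlet series converges absolutely at every point of the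
open right half-plane. -/
theorem mem_absConvSubmodule_iff (a : ℕ → ℂ) :
    a ∈ absConvSubmodule ↔ a 0 = 0 ∧ ∀ s : ℂ, 0 < s.re → LSeriesSummable a s := by
  have key : a 0 = 0 → ∀ s : ℂ,
      (LSeriesSummable a s ↔ Summable fun n : ℕ => ‖a n‖ * (n : ℝ) ^ (-s.re)) := by
    intro h0 s
    unfold LSeriesSummable
    rw [← summable_norm_iff]
    refine summable_congr fun n => ?_
    rw [LSeries.norm_term_eq]
    split_ifs with hn
    · simp [hn, h0]
    · rw [Real.rpow_neg (Nat.cast_nonneg n), div_eq_mul_inv]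
  constructor
  · rintro ⟨h0, h⟩
    exact ⟨h0, fun s hs => (key h0 s).2 (h s.re hs)⟩
  · rintro ⟨h0, h⟩
    exact ⟨h0, fun σ hσ => by simpa using (key h0 (σ : ℂ)).1 (h (σ : ℂ) (by simpa using hσ))⟩

/-- The space `D_a(ℂ₊)` of Dirichlet series absolutely convergent in the open right half-plane.
It is a type of its own, so that it does not inherit the topology of pointwise convergence of
coefficients from `ℕ → ℂ`. -/
def Da : Type := absConvSubmodule

instance : AddCommGroup Da := inferInstanceAs (AddCommGroup absConvSubmodule)

instance : Module ℂ Da := inferInstanceAs (Module ℂ absConvSubmodule)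

/-- The coefficients of a Dirichlet series. -/
def Da.coeff (D : Da) : ℕ → ℂ := D.1

theorem Da.coeff_add (D E : Da) : (D + E).coeff = D.coeff + E.coeff := rfl

theorem Da.coeff_smul (c : ℂ) (D : Da) : (c • D).coeff = c • D.coeff := rfl

theorem Da.summable (D : Da) {σ : ℝ} (hσ : 0 < σ) :
    Summable fun n : ℕ => ‖D.coeff n‖ * (n : ℝ) ^ (-σ) := D.2.2 σ hσ

/-- The norm `‖∑ a_n n^{-s}‖_σ = ∑ |a_n| n^{-σ}`, for `σ > 0`. -/
def Da.seminorm (σ : {σ : ℝ // 0 < σ}) : Seminorm ℂ Da :=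
  Seminorm.of (fun D => ∑' n : ℕ, ‖D.coeff n‖ * (n : ℝ) ^ (-(σ : ℝ)))
    (by
      intro D E
      rw [← (D.summable σ.2).tsum_add (E.summable σ.2)]
      refine ((D + E).summable σ.2).tsum_le_tsum (fun n => ?_)
        ((D.summable σ.2).add (E.summable σ.2))
      rw [← add_mul]
      exact mul_le_mul_of_nonneg_right (norm_add_le _ _) (by positivity))
    (by
      intro c D
      simp only [Da.coeff_smul, Pi.smul_apply, smul_eq_mul, norm_mul, mul_assoc]
      exact tsum_mul_left)

instance : Nonempty {σ : ℝ // 0 < σ} := ⟨⟨1, one_pos⟩⟩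

/-- The topology of `D_a(ℂ₊)` is the one induced by all the seminorms `‖·‖_σ`, `σ > 0`. -/
instance : TopologicalSpace Da :=
  (SeminormFamily.moduleFilterBasis (p := (Da.seminorm : SeminormFamily ℂ Da {σ : ℝ // 0 < σ}))).topology

theorem Da.withSeminorms : WithSeminorms (𝕜 := ℂ) (E := Da) Da.seminorm := ⟨rfl⟩

/-- The partial sum `S_N D (s) = ∑_{n=1}^N a_n n^{-s}`. -/
def Da.partialSum (D : Da) (N : ℕ) (s : ℂ) : ℂ :=
  ∑ n ∈ Finset.Icc 1 N, D.coeff n * (n : ℂ) ^ (-s)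

/-- For every entire function `g`, some subsequence of the partial sums of `D` converges to `g`,
together with all derivatives, uniformly on each compact subset of the closed left half-plane. -/
def Da.IsUniversal (D : Da) : Prop :=
  ∀ g : ℂ → ℂ, Differentiable ℂ g →
    ∃ lam : ℕ → ℕ, StrictMono lam ∧
      ∀ (l : ℕ) (K : Set ℂ), IsCompact K → K ⊆ {s : ℂ | s.re ≤ 0} →
        TendstoUniformlyOn (fun j : ℕ => iteratedDeriv l (D.partialSum (lam j)))
          (iteratedDeriv l g) atTop K

end DirichletSeries

end

/-! Everything rests on one approximation property (`exists_dirichletPolynomial_approx`): if δ < σ,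
an entire g is uniformly close, on a compact subset of Re s ≤ δ, to Dirichlet polynomials with high
frequencies and small ‖·‖_σ. By Hahn–Banach in ℓ¹ × C(K), it suffices that a functional L on C(K)
with L(n^{-s}) = O(n^{-σ}) kills entire functions. Let φ(z) = L(e^{-zs}), of exponential type. High
derivatives of x ↦ φ(log x) are O(x^{-σ}), so interpolation between integers yields φ(t) =
O(e^{-σt}) for large t, while Re s ≤ δ gives φ(t) = O(e^{-δt}) for t ≤ 0. Hence e^{(δ+σ)z/2}φ(z)
decays exponentially in both real directions and vanishes by Phragmén–Lindelöf
(`eq_zero_of_exponentialType_of_decay`); differentiating φ at 0 shows that L kills all powers of s.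
Adding such a polynomial to a truncated series, beyond its last term, barely moves it and brings all
late partial sums near a prescribed g. Baire's theorem in the Polish space `Da` then gives a dense
set of universal series. For the subspace, universal series are picked inductively, each along a
subsequence on which the partial sums of all earlier ones tend to 0. -/

open Filter Topology

noncomputable section

namespace DirichletSeries

/-! ### Universality for sequences of operators -/

section Abstract

variable {E X : Type*} [AddCommGroup E] [Module ℂ E] [TopologicalSpace E]
  [AddCommGroup X] [Module ℂ X] [TopologicalSpace X]

/-- The vectors `D` for which every element of `G` is a cluster point of the orbit `T N D`. -/
def universalSet (T : ℕ → E →L[ℂ] X) (G : Set X) : Set E :=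
  {D | ∀ g ∈ G, MapClusterPt g atTop fun N => T N D}

theorem universalSet_eq_biInter [SecondCountableTopology X] (T : ℕ → E →L[ℂ] X) (G : Set X) :
    universalSet T G =
      ⋂ p ∈ {B | B ∈ TopologicalSpace.countableBasis X ∧ (B ∩ G).Nonempty} ×ˢ (Set.univ : Set ℕ),
        ⋃ N ≥ p.2, T N ⁻¹' p.1 := by
  ext D
  simp only [universalSet, Set.mem_ofPred_eq, Set.mem_iInter, Set.mem_iUnion, Set.mem_preimage,
    Set.mem_prod, Set.mem_univ, and_true, Prod.forall, mapClusterPt_iff_frequently,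
    frequently_atTop]
  constructor
  · rintro h B M ⟨hB, g, hgB, hgG⟩
    obtain ⟨N, hN, hN'⟩ := h g hgG B
      (((TopologicalSpace.isBasis_countableBasis X).isOpen hB).mem_nhds hgB) M
    exact ⟨N, hN, hN'⟩
  · intro h g hg s hs M
    obtain ⟨B, hB, hgB, hBs⟩ := (TopologicalSpace.isBasis_countableBasis X).mem_nhds_iff.1 hs
    obtain ⟨N, hN, hN'⟩ := h B M ⟨hB, g, hgB, hg⟩
    exact ⟨N, hN, hBs hN'⟩

theorem isGδ_universalSet [SecondCountableTopology X] (T : ℕ → E →L[ℂ] X) (G : Set X) :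
    IsGδ (universalSet T G) := by
  rw [universalSet_eq_biInter]
  refine .biInter (((TopologicalSpace.countable_countableBasis X).mono
    fun _ h => h.1).prod Set.countable_univ) fun p hp => IsOpen.isGδ ?_
  exact isOpen_iUnion fun N => isOpen_iUnion fun _ =>
    ((TopologicalSpace.isBasis_countableBasis X).isOpen hp.1.1).preimage (T N).continuous

/-- Baire category. Asking for "eventually" in `hT`, where "frequently" would do, makes the
hypothesis pass to subsequences of `T`. -/
theorem dense_universalSet [SecondCountableTopology X] [BaireSpace E] {T : ℕ → E →L[ℂ] X}
    {G : Set X}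
    (hT : ∀ g ∈ G, ∀ B, IsOpen B → g ∈ B → Dense {D | ∀ᶠ N in atTop, T N D ∈ B}) :
    Dense (universalSet T G) := by
  rw [universalSet_eq_biInter]
  refine dense_biInter_of_isOpen (fun p hp => ?_) (((TopologicalSpace.countable_countableBasis
    X).mono fun _ h => h.1).prod Set.countable_univ) fun p hp => ?_
  · exact isOpen_iUnion fun N => isOpen_iUnion fun _ =>
      ((TopologicalSpace.isBasis_countableBasis X).isOpen hp.1.1).preimage (T N).continuous
  · obtain ⟨g, hgB, hgG⟩ := hp.1.2
    refine (hT g hgG p.1 ((TopologicalSpace.isBasis_countableBasis X).isOpen hp.1.1) hgB).mono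
      fun D hD => ?_
    obtain ⟨N, hN, hN'⟩ := (hD.and (eventually_ge_atTop p.2)).exists
    exact Set.mem_iUnion₂.2 ⟨N, hN', hN⟩

/-- `F n` lies in the `n`-th basic open set and is universal along `μ n`; `μ (n + 1)` refines `μ n`
so that the orbit of `F n` tends to 0 along it. The span of the `F n` works. -/
theorem exists_dense_submodule_universalSet [IsTopologicalAddGroup X] [ContinuousSMul ℂ X]
    [SecondCountableTopology X] [BaireSpace E] [SecondCountableTopology E]
    {T : ℕ → E →L[ℂ] X} {G : Submodule ℂ X}
    (hT : ∀ g ∈ G, ∀ B, IsOpen B → g ∈ B → Dense {D | ∀ᶠ N in atTop, T N D ∈ B}) :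
    ∃ V : Submodule ℂ E, Dense (V : Set E) ∧ ∀ D ∈ V, D ≠ 0 → D ∈ universalSet T (G : Set X) := by
  have step : ∀ (B : {B : Set E // IsOpen B ∧ B.Nonempty}) (μ : {μ : ℕ → ℕ // StrictMono μ}),
      ∃ (D : E) (ν : ℕ → ℕ), StrictMono ν ∧ D ∈ B.1 ∧
        D ∈ universalSet (fun N => T (μ.1 N)) (G : Set X) ∧
        Tendsto (fun n => T (μ.1 (ν n)) D) atTop (𝓝 0) := by
    rintro ⟨B, hB, hBne⟩ ⟨μ, hμ⟩
    have hd : Dense (universalSet (fun N => T (μ N)) (G : Set X)) :=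
      dense_universalSet fun g hg B hB hgB => (hT g hg B hB hgB).mono fun D hD =>
        hμ.tendsto_atTop.eventually (p := fun N => T N D ∈ B) hD
    obtain ⟨D, hDB, hD⟩ := hd.inter_open_nonempty B hB hBne
    -- Since 0 is a target, universality itself supplies the annihilating subsequence.
    obtain ⟨ν, hν, hν'⟩ := (hD 0 G.zero_mem).tendsto_subseq
    exact ⟨D, ν, hν, hDB, hD, hν'⟩
  choose D ν hν hDB hDU hD0 using step
  obtain ⟨b, hbc, hb0, hb⟩ := TopologicalSpace.exists_countable_basis E
  have hbne : b.Nonempty := by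
    obtain ⟨u, hu, -⟩ := hb.mem_nhds_iff.1 (univ_mem : Set.univ ∈ 𝓝 (0 : E))
    exact ⟨u, hu⟩
  obtain ⟨e, he⟩ := hbc.exists_eq_range hbne
  have heb : ∀ n, e n ∈ b := fun n => he ▸ Set.mem_range_self n
  have hne : ∀ n, (e n).Nonempty := fun n =>
    Set.nonempty_iff_ne_empty.2 fun h => hb0 (h ▸ heb n)
  let B : ℕ → {B : Set E // IsOpen B ∧ B.Nonempty} := fun n => ⟨e n, hb.isOpen (heb n), hne n⟩
  let μ : ℕ → {μ : ℕ → ℕ // StrictMono μ} := fun n => Nat.rec ⟨id, strictMono_id⟩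
    (fun n μ => ⟨μ.1 ∘ ν (B n) μ, μ.2.comp (hν (B n) μ)⟩) n
  have hμ : ∀ n, (μ (n + 1)).1 = (μ n).1 ∘ ν (B n) (μ n) := fun n => rfl
  let F : ℕ → E := fun n => D (B n) (μ n)
  have hsub : ∀ i j, ∃ ρ : ℕ → ℕ, StrictMono ρ ∧ (μ (i + j)).1 = (μ i).1 ∘ ρ := by
    intro i j
    induction j with
    | zero => exact ⟨id, strictMono_id, rfl⟩
    | succ j ih =>
      obtain ⟨ρ, hρ, h⟩ := ih
      exact ⟨ρ ∘ ν (B (i + j)) (μ (i + j)), hρ.comp (hν _ _), by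
        rw [← add_assoc, hμ, h]; rfl⟩
  have hF0 : ∀ i k, i < k → Tendsto (fun n => T ((μ k).1 n) (F i)) atTop (𝓝 0) := by
    intro i k hik
    obtain ⟨j, rfl⟩ := Nat.exists_eq_add_of_lt hik
    obtain ⟨ρ, hρ, h⟩ := hsub (i + 1) j
    rw [show i + j + 1 = i + 1 + j by ring, h]
    exact (hD0 (B i) (μ i)).comp hρ.tendsto_atTop
  refine ⟨Submodule.span ℂ (Set.range F), ?_, ?_⟩
  · refine Dense.mono Submodule.subset_span (hb.dense_iff.2 fun o ho _ => ?_)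
    obtain ⟨n, rfl⟩ := (he ▸ ho : o ∈ Set.range e)
    exact ⟨F n, hDB (B n) (μ n), n, rfl⟩
  · intro x hx hx0 g hg
    obtain ⟨c, rfl⟩ := (Finsupp.mem_span_range_iff_exists_finsupp).1 hx
    have hc : c.support.Nonempty := Finsupp.support_nonempty_iff.2 fun h => hx0 (by simp [h])
    -- Along `μ k` all `F i` with `i < k` die out and only the term `c k • F k` matters; hence the
    -- target rescaled by `(c k)⁻¹`.
    set k := c.support.max' hc with hk
    have hck : c k ≠ 0 := Finsupp.mem_support_iff.1 (c.support.max'_mem hc)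
    obtain ⟨ψ, hψ, hlim⟩ := (hDU (B k) (μ k) ((c k)⁻¹ • g) (G.smul_mem _ hg)).tendsto_subseq
    have key : Tendsto (fun n => T ((μ k).1 (ψ n)) (c.sum fun i a => a • F i)) atTop (𝓝 g) := by
      have h1 : ∀ i ∈ c.support, Tendsto (fun n => c i • T ((μ k).1 (ψ n)) (F i)) atTop
          (𝓝 (if i = k then g else 0)) := by
        intro i hi
        split_ifs with hik
        · rw [hik]
          simpa [smul_smul, hck] using hlim.const_smul (c k)
        · have hlt : i < k := lt_of_le_of_ne (Finset.le_max' _ _ hi) hik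
          simpa using ((hF0 i k hlt).comp hψ.tendsto_atTop).const_smul (c i)
      have h2 := tendsto_finsetSum c.support h1
      rw [Finset.sum_ite_eq' c.support k, if_pos (c.support.max'_mem hc)] at h2
      refine h2.congr fun n => ?_
      rw [Finsupp.sum, map_sum]
      simp
    exact MapClusterPt.of_comp ((μ k).2.comp hψ).tendsto_atTop key.mapClusterPt

end Abstract

/-! ### A vanishing theorem of Phragmén–Lindelöf type -/

/-- Only the argument, at most π/2 in modulus, contributes growth: the shift by 1 keeps log |w + 1|
nonnegative, and it moves the branch point out of the half-plane. -/
theorem norm_exp_neg_mul_log_le {a : ℝ} (ha : 0 ≤ a) {w : ℂ} (hw : 0 ≤ w.re) :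
    ‖Complex.exp (-(a * ((w + 1) * Complex.log (w + 1))))‖
      ≤ Real.exp (a * (Real.pi / 2) * |w.im|) := by
  rw [Complex.norm_exp, Real.exp_le_exp]
  have h1 : 1 ≤ ‖w + 1‖ := by
    refine le_trans ?_ (Complex.re_le_norm (w + 1))
    simpa using hw
  have h2 : |(w + 1).arg| ≤ Real.pi / 2 := Complex.abs_arg_le_pi_div_two_iff.2 (by
    simp; linarith)
  have h3 : w.im * (w + 1).arg ≤ |w.im| * (Real.pi / 2) := by
    refine (le_abs_self _).trans ?_
    rw [abs_mul]
    gcongr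
  have h4 : 0 ≤ (w.re + 1) * Real.log ‖w + 1‖ :=
    mul_nonneg (by linarith) (Real.log_nonneg h1)
  have h5 : (-(a * ((w + 1) * Complex.log (w + 1)))).re
      = a * (w.im * (w + 1).arg - (w.re + 1) * Real.log ‖w + 1‖) := by
    simp [Complex.log_re, Complex.log_im]
    ring
  rw [h5, mul_assoc]
  refine mul_le_mul_of_nonneg_left ?_ ha
  linarith

/-- An entire function of exponential type which decays exponentially along the real axis in both
directions vanishes there. -/
theorem eq_zero_of_exponentialType_of_decay {h : ℂ → ℂ} (hd : Differentiable ℂ h) {A C c : ℝ}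
    (hc : 0 < c) (hgrowth : ∀ z, ‖h z‖ ≤ C * Real.exp (A * ‖z‖))
    (hdecay : ∀ t : ℝ, ‖h t‖ ≤ C * Real.exp (-c * |t|)) (t : ℝ) : h t = 0 := by
  have hC : 0 ≤ C := by simpa using (norm_nonneg _).trans (hgrowth 0)
  -- With this `a`, the growth of the multiplier on the imaginary axis is absorbed by the decay of
  -- `h`.
  set a : ℝ := 2 * c / Real.pi with ha
  have ha0 : 0 < a := by positivity
  have hac : a * (Real.pi / 2) = c := by
    rw [ha]; field_simp
  -- Rotation sends the real axis to the boundary of the right half-plane; the second factor forces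
  -- superexponential decay on the positive real axis.
  let F : ℂ → ℂ := fun w =>
    h (Complex.I * w) * Complex.exp (-(a * ((w + 1) * Complex.log (w + 1))))
  have hFb : ∀ w : ℂ, 0 ≤ w.re → ‖F w‖ ≤ ‖h (Complex.I * w)‖ * Real.exp (c * |w.im|) := by
    intro w hw
    rw [norm_mul]
    have := norm_exp_neg_mul_log_le ha0.le hw
    rw [hac] at this
    gcongr
  have hFd : DiffContOnCl ℂ F {z | 0 < z.re} := by
    refine DifferentiableOn.diffContOnCl ?_
    rw [Complex.closure_setOfPred_lt_re]
    intro w hw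
    have hsl : w + 1 ∈ Complex.slitPlane := Or.inl (by
      have : 0 ≤ w.re := hw
      simp; linarith)
    refine DifferentiableAt.differentiableWithinAt ?_
    refine DifferentiableAt.mul ?_ ?_
    · exact (hd _).comp w (by fun_prop)
    · exact ((((differentiableAt_id.add_const 1).mul
        ((differentiableAt_id.add_const 1).clog hsl)).const_mul _).neg).cexp
  have hF0 := PhragmenLindelof.eq_zero_on_right_half_plane_of_superexponential_decay hFd
    ⟨1, by norm_num, A + c, ?_⟩ ?_ ⟨C, ?_⟩
  · have h0 : (0 : ℝ) ≤ (-Complex.I * t).re := by simp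
    have := hF0 h0
    simp only [F, Pi.zero_apply, mul_eq_zero, Complex.exp_ne_zero, or_false] at this
    rwa [← mul_assoc, mul_neg, Complex.I_mul_I, neg_neg, one_mul] at this
  · refine Asymptotics.IsBigO.of_bound C ?_
    refine eventually_inf_principal.2 (Eventually.of_forall fun w hw => ?_)
    have hw' : 0 ≤ w.re := le_of_lt hw
    refine (hFb w hw').trans ?_
    rw [Real.rpow_one, Real.norm_of_nonneg (Real.exp_pos _).le, add_mul, Real.exp_add, ← mul_assoc]
    have h1 := hgrowth (Complex.I * w)
    rw [norm_mul, Complex.norm_I, one_mul] at h1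
    have h2 := Complex.abs_im_le_norm w
    gcongr
  · intro n
    have hlim : Tendsto (fun x : ℝ => C * Real.exp (x * (n + A - a * Real.log x))) atTop (𝓝 0) := by
      rw [← mul_zero C]
      refine (Real.tendsto_exp_atBot.comp ?_).const_mul C
      refine tendsto_id.atTop_mul_atBot₀ ?_
      have := (Real.tendsto_log_atTop.const_mul_atTop ha0)
      exact tendsto_atBot_add_const_left _ _ (tendsto_neg_atTop_atBot.comp this)
    refine squeeze_zero' (Eventually.of_forall fun x => by positivity) ?_ hlim
    filter_upwards [eventually_ge_atTop 1] with x hx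
    have hx0 : 0 < x := by linarith
    have h1 : ‖Complex.exp (-(a * (((x : ℂ) + 1) * Complex.log (x + 1))))‖
        ≤ Real.exp (-(a * (x * Real.log x))) := by
      rw [show ((x : ℂ) + 1) = ((x + 1 : ℝ) : ℂ) by push_cast; rfl,
        ← Complex.ofReal_log (by linarith), Complex.norm_exp, Real.exp_le_exp]
      have : (-((a : ℂ) * (((x + 1 : ℝ) : ℂ) * (Real.log (x + 1) : ℂ)))).re
          = -(a * ((x + 1) * Real.log (x + 1))) := by
        rw [← Complex.ofReal_mul, ← Complex.ofReal_mul, ← Complex.ofReal_neg, Complex.ofReal_re]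
      rw [this, neg_le_neg_iff]
      have hl := Real.log_nonneg hx
      have hle : Real.log x ≤ Real.log (x + 1) := Real.log_le_log hx0 (by linarith)
      gcongr
      linarith
    have h2 := hgrowth (Complex.I * x)
    rw [norm_mul, Complex.norm_I, one_mul, Complex.norm_real, Real.norm_of_nonneg hx0.le] at h2
    calc Real.exp x ^ n * ‖F x‖
        ≤ Real.exp x ^ n * ((C * Real.exp (A * x)) * Real.exp (-(a * (x * Real.log x)))) := by
          rw [norm_mul]
          gcongr
      _ = C * Real.exp (x * (n + A - a * Real.log x)) := by
          rw [← Real.exp_nat_mul, show x * (n + A - a * Real.log x)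
            = n * x + A * x + -(a * (x * Real.log x)) by ring, Real.exp_add, Real.exp_add]
          ring
  · intro x
    refine (hFb _ (by simp)).trans ?_
    have h1 : Complex.I * (x * Complex.I) = ((-x : ℝ) : ℂ) := by
      rw [mul_left_comm, Complex.I_mul_I]; simp
    have h2 := hdecay (-x)
    rw [h1]
    have h3 : ((x : ℂ) * Complex.I).im = x := by simp
    rw [h3]
    rw [abs_neg] at h2
    calc _ ≤ C * Real.exp (-c * |x|) * Real.exp (c * |x|) := by gcongr
      _ = C := by rw [mul_assoc, ← Real.exp_add]; simp

/-! ### From bounds at integers to bounds on a half-line -/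

/-- Lagrange interpolation at 0, …, k - 1: `B` sums bounds of the basis polynomials on [0, 1], so it
depends on `k` alone. -/
theorem exists_bound_of_bound_at_nat (k : ℕ) :
    ∃ B : ℝ, 0 ≤ B ∧ ∀ (c : ℕ → ℂ) (ε : ℝ),
      (∀ j < k, ‖∑ i ∈ Finset.range k, c i * (j : ℂ) ^ i‖ ≤ ε) →
      ∀ u ∈ Set.Icc (0 : ℝ) 1, ‖∑ i ∈ Finset.range k, c i * (u : ℂ) ^ i‖ ≤ B * ε := by
  have hb : ∀ j : ℕ, ∃ b : ℝ, ∀ u ∈ Set.Icc (0 : ℝ) 1,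
      ‖(Lagrange.basis (Finset.range k) (fun n : ℕ => (n : ℂ)) j).eval (u : ℂ)‖ ≤ b := fun j =>
    isCompact_Icc.exists_bound_of_continuousOn
      (((Lagrange.basis _ _ j).continuous.comp Complex.continuous_ofReal).continuousOn)
  choose b hb using hb
  have hb0 : ∀ j, 0 ≤ b j := fun j => (norm_nonneg _).trans (hb j 0 (by simp))
  refine ⟨∑ j ∈ Finset.range k, b j, Finset.sum_nonneg fun j _ => hb0 j, fun c ε h u hu => ?_⟩
  set p : Polynomial ℂ := ∑ i ∈ Finset.range k, Polynomial.C (c i) * Polynomial.X ^ i with hp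
  have hpe : ∀ z : ℂ, p.eval z = ∑ i ∈ Finset.range k, c i * z ^ i := fun z => by
    simp [hp, Polynomial.eval_finsetSum]
  have hdeg : p.degree < (Finset.range k).card := by
    rw [Finset.card_range]
    refine (Polynomial.degree_sum_le _ _).trans_lt ((Finset.sup_lt_iff (by simp)).2 fun i hi => ?_)
    exact (Polynomial.degree_C_mul_X_pow_le i _).trans_lt (by exact_mod_cast Finset.mem_range.1 hi)
  have heq := Lagrange.eq_interpolate (s := Finset.range k) (v := fun n : ℕ => (n : ℂ))
    (f := p) (fun a _ b _ hab => by simpa using hab) hdeg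
  rw [← hpe, heq, Lagrange.interpolate_apply, Polynomial.eval_finsetSum, Finset.sum_mul]
  refine norm_sum_le_of_le _ fun j hj => ?_
  rw [Polynomial.eval_mul, Polynomial.eval_C, norm_mul, mul_comm, hpe]
  exact mul_le_mul (hb j u hu) (h j (Finset.mem_range.1 hj)) (norm_nonneg _) (hb0 j)

/-- The derivative of the remainder is the remainder of one order less for `F 1`; induction and the
mean value inequality do the rest. -/
theorem norm_sub_taylor_le {k : ℕ} {F : ℕ → ℝ → ℂ} {a b M : ℝ}
    (hF : ∀ i < k, ∀ x ∈ Set.Icc a b, HasDerivAt (F i) (F (i + 1) x) x)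
    (hM : ∀ x ∈ Set.Icc a b, ‖F k x‖ ≤ M) :
    ∀ x ∈ Set.Icc a b,
      ‖F 0 x - ∑ i ∈ Finset.range k, F i a / (i.factorial : ℂ) * ((x - a : ℝ) : ℂ) ^ i‖
        ≤ M * (b - a) ^ k := by
  induction k generalizing F with
  | zero => simpa using hM
  | succ k ih =>
    intro x hx
    have hab : a ≤ b := hx.1.trans hx.2
    have hM0 : 0 ≤ M := (norm_nonneg _).trans (hM x hx)
    have ih' := ih (F := fun i => F (i + 1)) (fun i hi => hF (i + 1) (by omega)) hM
    set R : ℝ → ℂ := fun x =>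
      F 0 x - ∑ i ∈ Finset.range (k + 1), F i a / (i.factorial : ℂ) * ((x - a : ℝ) : ℂ) ^ i with hR
    have hder : ∀ y ∈ Set.Icc a b, HasDerivWithinAt R
        (F 1 y - ∑ i ∈ Finset.range k, F (i + 1) a / (i.factorial : ℂ) * ((y - a : ℝ) : ℂ) ^ i)
        (Set.Icc a b) y := by
      intro y hy
      refine HasDerivAt.hasDerivWithinAt ((hF 0 (by omega) y hy).sub ?_)
      have h1 : ∀ i : ℕ, HasDerivAt
          (fun x : ℝ => F i a / (i.factorial : ℂ) * ((x - a : ℝ) : ℂ) ^ i)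
          (F i a / (i.factorial : ℂ) * (i * ((y - a : ℝ) : ℂ) ^ (i - 1))) y := by
        intro i
        have h0 : HasDerivAt (fun x : ℝ => ((x - a : ℝ) : ℂ)) 1 y := by
          simpa using ((hasDerivAt_id y).sub_const a).ofReal_comp
        simpa using (h0.fun_pow i).const_mul (F i a / (i.factorial : ℂ))
      have h2 := HasDerivAt.fun_sum (u := Finset.range (k + 1)) fun i _ => h1 i
      convert h2 using 1
      rw [Finset.sum_range_succ']
      simp only [Nat.cast_zero, zero_mul, mul_zero, add_zero, Nat.add_sub_cancel]
      refine Finset.sum_congr rfl fun i _ => ?_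
      rw [Nat.factorial_succ]
      have : ((i : ℂ) + 1) ≠ 0 := Nat.cast_add_one_ne_zero i
      have : (i.factorial : ℂ) ≠ 0 := by exact_mod_cast i.factorial_ne_zero
      push_cast
      field_simp
    have hmv := norm_image_sub_le_of_norm_deriv_le_segment' hder
      (fun y hy => ih' y (Set.Ico_subset_Icc_self hy)) x hx
    have hRa : R a = 0 := by
      simp [hR, Finset.sum_range_succ']
    rw [hRa, sub_zero] at hmv
    refine hmv.trans ?_
    rw [pow_succ, ← mul_assoc]
    have : 0 ≤ b - a := sub_nonneg.2 hab
    have := hx.2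
    gcongr

/-- A function bounded by a multiple of `n ^ (-σ)` at the integers, with a derivative of some order
bounded by a multiple of `x ^ (-σ)`, is itself bounded by a multiple of `x ^ (-σ)`. -/
theorem exists_bound_rpow_of_bound_at_nat {F : ℕ → ℝ → ℂ} {k N : ℕ} (hk : 1 ≤ k) (hN : 1 ≤ N)
    {C σ : ℝ} (hσ : 0 ≤ σ) (hC : 0 ≤ C)
    (hF : ∀ i, ∀ x : ℝ, 0 < x → HasDerivAt (F i) (F (i + 1) x) x)
    (h0 : ∀ n : ℕ, N ≤ n → ‖F 0 n‖ ≤ C * (n : ℝ) ^ (-σ))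
    (hFk : ∀ x : ℝ, N ≤ x → ‖F k x‖ ≤ C * x ^ (-σ)) :
    ∃ C', 0 ≤ C' ∧ ∀ x : ℝ, N ≤ x → ‖F 0 x‖ ≤ C' * x ^ (-σ) := by
  obtain ⟨B, hB0, hB⟩ := exists_bound_of_bound_at_nat k
  -- The first summand bounds the Taylor polynomial at n = ⌊x⌋, the second the Taylor error; `2 ^ σ`
  -- turns n^{-σ} into x^{-σ}, as x / 2 ≤ n.
  refine ⟨(B * (C + C * (k : ℝ) ^ k) + C * (k : ℝ) ^ k) * 2 ^ σ, by positivity, fun x hx => ?_⟩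
  have hN' : (1 : ℝ) ≤ N := by exact_mod_cast hN
  have hx0 : 0 ≤ x := by linarith
  set n : ℕ := ⌊x⌋₊ with hn
  have hnN : N ≤ n := Nat.le_floor hx
  have hn1 : (1 : ℝ) ≤ n := by exact_mod_cast hN.trans hnN
  have hnx : (n : ℝ) ≤ x := Nat.floor_le hx0
  have hxn : x < n + 1 := Nat.lt_floor_add_one x
  have hk' : (1 : ℝ) ≤ k := by exact_mod_cast hk
  set q : ℝ := (n : ℝ) ^ (-σ) with hq
  have hq0 : 0 ≤ q := by positivity
  have hanti : ∀ y : ℝ, (n : ℝ) ≤ y → y ^ (-σ) ≤ q := fun y hy =>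
    Real.rpow_le_rpow_of_nonpos (by linarith) hy (by linarith)
  -- Length `k` makes room for all interpolation nodes n, …, n + k - 1.
  have hT := norm_sub_taylor_le (k := k) (F := F) (a := n) (b := n + k) (M := C * q)
    (fun i _ y hy => hF i y (by linarith [hy.1]))
    (fun y hy => (hFk y (le_trans (by exact_mod_cast hnN) hy.1)).trans
      (mul_le_mul_of_nonneg_left (hanti y hy.1) hC))
  rw [add_sub_cancel_left] at hT
  have hnode : ∀ j < k, ‖∑ i ∈ Finset.range k, F i n / (i.factorial : ℂ) * (j : ℂ) ^ i‖
      ≤ (C + C * (k : ℝ) ^ k) * q := by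
    intro j hj
    have h1 := hT (n + j) ⟨by simp, by gcongr⟩
    have h2 : ‖F 0 (n + j)‖ ≤ C * q := by
      have := h0 (n + j) (by omega)
      push_cast at this
      exact this.trans (mul_le_mul_of_nonneg_left (hanti _ (by simp)) hC)
    rw [add_sub_cancel_left] at h1
    have h3 := norm_sub_norm_le (∑ i ∈ Finset.range k, F i n / (i.factorial : ℂ) * (j : ℂ) ^ i)
      (F 0 (n + j))
    rw [norm_sub_rev] at h1
    push_cast at h1
    linarith
  have h4 := hB (fun i => F i n / (i.factorial : ℂ)) _ hnode (x - n) ⟨by linarith, by linarith⟩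
  have h5 := hT x ⟨hnx, by linarith⟩
  have h6 := norm_sub_norm_le (F 0 x)
    (∑ i ∈ Finset.range k, F i n / (i.factorial : ℂ) * ((x - n : ℝ) : ℂ) ^ i)
  have h7 : q ≤ 2 ^ σ * x ^ (-σ) := by
    have hxx : x / 2 ≤ n := by linarith
    have : q ≤ (x / 2) ^ (-σ) :=
      Real.rpow_le_rpow_of_nonpos (by linarith) hxx (by linarith)
    rwa [div_eq_mul_inv, Real.mul_rpow hx0 (by positivity), Real.inv_rpow (by positivity),
      Real.rpow_neg (by positivity : (0 : ℝ) ≤ 2), inv_inv, mul_comm] at this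
  calc ‖F 0 x‖ ≤ (B * (C + C * (k : ℝ) ^ k) + C * (k : ℝ) ^ k) * q := by linarith
    _ ≤ (B * (C + C * (k : ℝ) ^ k) + C * (k : ℝ) ^ k) * (2 ^ σ * x ^ (-σ)) := by gcongr
    _ = _ := by ring

/-! ### Functionals on exponentials in a Banach algebra -/

section Algebra

variable {A : Type*} [NormedCommRing A] [NormedAlgebra ℂ A] [CompleteSpace A]

/-- If `L (exp (z • y))` vanishes for all real `z`, then `L` vanishes on all powers of `y`. -/
theorem map_pow_eq_zero_of_map_exp_eq_zero (L : A →L[ℂ] ℂ) (y : A)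
    (h : ∀ t : ℝ, L (NormedSpace.exp ((t : ℂ) • y)) = 0) (k : ℕ) : L (y ^ k) = 0 := by
  have key : ∀ k : ℕ, ∀ t : ℝ, L (NormedSpace.exp ((t : ℂ) • y) * y ^ k) = 0 := by
    intro k
    induction k with
    | zero => simpa using h
    | succ k ih =>
      intro t
      -- Differentiating the zero function brings down one more factor `y`.
      have h1 : HasDerivAt (fun u : ℂ => NormedSpace.exp (u • y) * y ^ k)
          (NormedSpace.exp ((t : ℂ) • y) * y * y ^ k) (t : ℂ) :=
        (hasDerivAt_exp_smul_const y (t : ℂ)).mul_const _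
      have h2 := (L.hasFDerivAt.comp_hasDerivAt _ h1).comp_ofReal
      have h3 : (fun t : ℝ => (L ∘ fun u : ℂ => NormedSpace.exp (u • y) * y ^ k) (t : ℂ))
          = fun _ => 0 := funext fun t => ih t
      rw [h3] at h2
      rw [pow_succ', ← mul_assoc]
      exact h2.unique (hasDerivAt_const _ _)
  simpa using key k 0

/-- The functions `x ↦ L (x ^ (-i) • c_i * exp (log x • y))`, with `c_i = y (y - 1) ⋯ (y - i + 1)`,
are the successive derivatives of `x ↦ L (exp (log x • y))`. -/
theorem hasDerivAt_map_exp_log (L : A →L[ℂ] ℂ) (y : A) (c : ℕ → A)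
    (hc : ∀ i : ℕ, c (i + 1) = (y - algebraMap ℂ A i) * c i) (i : ℕ) {x : ℝ} (hx : 0 < x) :
    HasDerivAt
      (fun x : ℝ => ((x : ℂ) ^ i)⁻¹ * L (NormedSpace.exp ((Real.log x : ℂ) • y) * c i))
      (((x : ℂ) ^ (i + 1))⁻¹ * L (NormedSpace.exp ((Real.log x : ℂ) • y) * c (i + 1))) x := by
  have hx' : (x : ℂ) ≠ 0 := by exact_mod_cast hx.ne'
  have h1 : HasDerivAt (fun u : ℂ => NormedSpace.exp (u • y) * c i)
      (NormedSpace.exp ((Real.log x : ℂ) • y) * y * c i) (Real.log x : ℂ) :=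
    (hasDerivAt_exp_smul_const y _).mul_const _
  have h2 := L.hasFDerivAt.comp_hasDerivAt _ h1
  have h3 : HasDerivAt (fun x : ℝ => (Real.log x : ℂ)) ((x⁻¹ : ℝ) : ℂ) x :=
    (Real.hasDerivAt_log hx.ne').ofReal_comp
  have h4 := HasDerivAt.comp x h2 h3
  have h5 : HasDerivAt (fun x : ℝ => ((x : ℂ) ^ i)⁻¹)
      (-(i * (x : ℂ) ^ (i - 1) * 1) / ((x : ℂ) ^ i) ^ 2) x := by
    have h0 : HasDerivAt (fun x : ℝ => (x : ℂ)) 1 x := by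
      simpa using (hasDerivAt_id x).ofReal_comp
    exact (h0.fun_pow i).fun_inv (pow_ne_zero _ hx')
  refine (h5.mul h4).congr_deriv ?_
  have e1 : NormedSpace.exp ((Real.log x : ℂ) • y) * c (i + 1)
      = NormedSpace.exp ((Real.log x : ℂ) • y) * y * c i
        - (i : ℂ) • (NormedSpace.exp ((Real.log x : ℂ) • y) * c i) := by
    rw [hc, Algebra.smul_def (i : ℂ)]; ring
  rw [e1, map_sub, map_smul]
  simp only [Function.comp_apply, smul_eq_mul, Complex.ofReal_inv]
  rcases i with _ | i
  · simp
    ring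
  · simp only [Nat.add_sub_cancel]
    field_simp
    ring

/-- The gap `δ < σ` is decisive: `L (exp (t • y))` is O(e^{-σt}) on the right and O(e^{-δt}) on the
left, so an exponential weight makes it decay both ways. -/
theorem map_pow_eq_zero_of_decay (L : A →L[ℂ] ℂ) (y : A) {R δ σ C : ℝ} {N : ℕ} (hσ : 0 ≤ σ)
    (hδσ : δ < σ) (hR : 0 ≤ R) (hC : 0 ≤ C)
    (hgrowth : ∀ z : ℂ, ‖NormedSpace.exp (z • y)‖ ≤ Real.exp (R * ‖z‖))
    (hneg : ∀ t : ℝ, t ≤ 0 → ‖NormedSpace.exp ((t : ℂ) • y)‖ ≤ Real.exp (-δ * t)) (hN : 1 ≤ N)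
    (hL : ∀ n : ℕ, N ≤ n →
      ‖L (NormedSpace.exp ((Real.log n : ℂ) • y))‖ ≤ C * (n : ℝ) ^ (-σ)) (k : ℕ) :
    L (y ^ k) = 0 := by
  refine map_pow_eq_zero_of_map_exp_eq_zero L y ?_ k
  have hN' : (1 : ℝ) ≤ N := by exact_mod_cast hN
  have hNl : 0 ≤ Real.log N := Real.log_nonneg hN'
  -- decay along the positive half-line, by interpolation
  obtain ⟨C₁, hC₁, hpos⟩ : ∃ C₁, 0 ≤ C₁ ∧ ∀ t : ℝ, Real.log N ≤ t →
      ‖L (NormedSpace.exp ((t : ℂ) • y))‖ ≤ C₁ * Real.exp (-σ * t) := by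
    let c : ℕ → A := fun i => Nat.rec 1 (fun i b => (y - algebraMap ℂ A i) * b) i
    have hc : ∀ i : ℕ, c (i + 1) = (y - algebraMap ℂ A i) * c i := fun i => rfl
    -- Each derivative in x gains a factor 1/x against the growth x^R; order `m + 1` reaches x^{-σ}.
    obtain ⟨m, hm⟩ := exists_nat_ge (R + σ)
    set F : ℕ → ℝ → ℂ := fun i x =>
      ((x : ℂ) ^ i)⁻¹ * L (NormedSpace.exp ((Real.log x : ℂ) • y) * c i) with hF
    have hF0 : ∀ x, F 0 x = L (NormedSpace.exp ((Real.log x : ℂ) • y)) := fun x => by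
      simp [hF, c]
    obtain ⟨C', hC', h⟩ := exists_bound_rpow_of_bound_at_nat (F := F) (k := m + 1) (N := N)
      (C := max C (‖L‖ * ‖c (m + 1)‖)) (σ := σ) (by omega) hN hσ (hC.trans (le_max_left _ _))
      (fun i x hx => hasDerivAt_map_exp_log L y c hc i hx)
      (fun n hn => by
        rw [hF0]
        exact (hL n hn).trans (by gcongr; exact le_max_left _ _))
      (fun x hx => by
        have hx1 : 1 ≤ x := hN'.trans hx
        have hx0 : 0 < x := by linarith
        rw [hF]
        simp only [norm_mul, norm_inv, norm_pow, Complex.norm_real, Real.norm_of_nonneg hx0.le]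
        have h1 : ‖L (NormedSpace.exp ((Real.log x : ℂ) • y) * c (m + 1))‖
            ≤ ‖L‖ * ‖c (m + 1)‖ * x ^ R := by
          have h2 := hgrowth (Real.log x)
          rw [Complex.norm_real, Real.norm_of_nonneg (Real.log_nonneg hx1), mul_comm,
            ← Real.rpow_def_of_pos hx0] at h2
          calc _ ≤ ‖L‖ * (‖NormedSpace.exp ((Real.log x : ℂ) • y)‖ * ‖c (m + 1)‖) :=
                (L.le_opNorm _).trans (by gcongr; exact norm_mul_le _ _)
            _ ≤ ‖L‖ * (x ^ R * ‖c (m + 1)‖) := by gcongr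
            _ = _ := by ring
        have h3 : (x ^ (m + 1))⁻¹ * x ^ R ≤ x ^ (-σ) := by
          rw [← Real.rpow_natCast, ← Real.rpow_neg hx0.le, ← Real.rpow_add hx0]
          refine Real.rpow_le_rpow_of_exponent_le hx1 ?_
          push_cast
          linarith
        calc _ ≤ (x ^ (m + 1))⁻¹ * (‖L‖ * ‖c (m + 1)‖ * x ^ R) := by gcongr
          _ = ‖L‖ * ‖c (m + 1)‖ * ((x ^ (m + 1))⁻¹ * x ^ R) := by ring
          _ ≤ max C (‖L‖ * ‖c (m + 1)‖) * x ^ (-σ) := by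
              gcongr
              exact le_max_right _ _)
    refine ⟨C', hC', fun t ht => ?_⟩
    have h1 := h (Real.exp t) (by
      rw [← Real.exp_log (by linarith : (0 : ℝ) < N)]
      exact Real.exp_le_exp.2 ht)
    rwa [hF0, Real.log_exp, ← Real.exp_mul, mul_comm t] at h1
  -- The midpoint weight balances both sides at the rate (σ - δ)/2.
  set h : ℂ → ℂ := fun z =>
    L (NormedSpace.exp (z • y)) * Complex.exp (((δ + σ) / 2 : ℝ) * z) with hh
  set ρ : ℝ := (δ + σ) / 2 with hρ
  set T : ℝ := Real.log N with hT
  -- Covers 0 ≤ t ≤ log N, where only the growth bound is available; the last factor offsets the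
  -- required decay.
  set C₂ : ℝ := ‖L‖ * Real.exp (R * T) * Real.exp (|ρ| * T) * Real.exp ((σ - δ) / 2 * T) with hC₂
  have hzero := eq_zero_of_exponentialType_of_decay (h := h) (A := R + |ρ|)
    (C := max C₁ (max ‖L‖ C₂)) (c := (σ - δ) / 2) ?_ (by linarith) ?_ ?_
  · intro t
    have := hzero t
    simpa [hh, Complex.exp_ne_zero] using this
  · intro z
    refine DifferentiableAt.mul ?_ (by fun_prop)
    exact (L.hasFDerivAt.comp_hasDerivAt _ (hasDerivAt_exp_smul_const y z)).differentiableAt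
  · intro z
    have h1 : ‖Complex.exp ((ρ : ℂ) * z)‖ ≤ Real.exp (|ρ| * ‖z‖) := by
      rw [Complex.norm_exp, Real.exp_le_exp]
      refine (Complex.re_le_norm _).trans ?_
      simp
    have h2 : ‖L (NormedSpace.exp (z • y))‖ ≤ ‖L‖ * Real.exp (R * ‖z‖) :=
      (L.le_opNorm _).trans (by gcongr; exact hgrowth z)
    rw [norm_mul, add_mul, Real.exp_add, ← mul_assoc]
    have h3 : ‖L‖ ≤ max C₁ (max ‖L‖ C₂) := (le_max_left _ _).trans (le_max_right _ _)
    refine mul_le_mul (h2.trans (by gcongr)) h1 (norm_nonneg _) ?_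
    exact mul_nonneg ((norm_nonneg _).trans h3) (Real.exp_pos _).le
  · intro t
    have h1 : ‖Complex.exp ((ρ : ℂ) * t)‖ = Real.exp (ρ * t) := by
      rw [Complex.norm_exp, ← Complex.ofReal_mul, Complex.ofReal_re]
    rw [norm_mul, h1]
    rcases le_total t 0 with ht | ht
    · rw [abs_of_nonpos ht]
      have h2 : ‖L (NormedSpace.exp ((t : ℂ) • y))‖ ≤ ‖L‖ * Real.exp (-δ * t) :=
        (L.le_opNorm _).trans (by gcongr; exact hneg t ht)
      calc _ ≤ ‖L‖ * Real.exp (-δ * t) * Real.exp (ρ * t) := by gcongr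
        _ = ‖L‖ * Real.exp (-((σ - δ) / 2) * -t) := by
            rw [mul_assoc, ← Real.exp_add]; congr 2; rw [hρ]; ring
        _ ≤ _ := by gcongr; exact (le_max_left _ _).trans (le_max_right _ _)
    · rw [abs_of_nonneg ht]
      rcases le_total T t with hTt | hTt
      · calc _ ≤ C₁ * Real.exp (-σ * t) * Real.exp (ρ * t) := by gcongr; exact hpos t hTt
          _ = C₁ * Real.exp (-((σ - δ) / 2) * t) := by
            rw [mul_assoc, ← Real.exp_add]; congr 2; rw [hρ]; ring
          _ ≤ _ := by gcongr; exact le_max_left _ _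
      · have h2 : ‖L (NormedSpace.exp ((t : ℂ) • y))‖ ≤ ‖L‖ * Real.exp (R * T) := by
          refine (L.le_opNorm _).trans ?_
          gcongr
          refine (hgrowth t).trans ?_
          rw [Complex.norm_real, Real.norm_of_nonneg ht]
          gcongr
        have h3 : ρ * t ≤ |ρ| * T := mul_le_mul (le_abs_self _) hTt ht (abs_nonneg _)
        have h4 : 1 ≤ Real.exp ((σ - δ) / 2 * T) * Real.exp (-((σ - δ) / 2) * t) := by
          rw [← Real.exp_add]
          refine Real.one_le_exp ?_
          nlinarith
        calc _ ≤ ‖L‖ * Real.exp (R * T) * Real.exp (|ρ| * T) * 1 := by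
              rw [mul_one]; gcongr
          _ ≤ ‖L‖ * Real.exp (R * T) * Real.exp (|ρ| * T)
              * (Real.exp ((σ - δ) / 2 * T) * Real.exp (-((σ - δ) / 2) * t)) := by gcongr
          _ = C₂ * Real.exp (-((σ - δ) / 2) * t) := by rw [hC₂]; ring
          _ ≤ _ := by gcongr; exact (le_max_right _ _).trans (le_max_right _ _)

end Algebra

/-! ### Approximation by Dirichlet polynomials via duality -/

/-- A point on which every continuous functional vanishing on a subspace vanishes belongs to the
closure of the subspace. -/
theorem mem_closure_of_forall_dual {X : Type*} [NormedAddCommGroup X] [NormedSpace ℂ X]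
    (M : Submodule ℂ X) (x : X)
    (h : ∀ f : X →L[ℂ] ℂ, (∀ m ∈ M, f m = 0) → f x = 0) : x ∈ closure (M : Set X) := by
  rw [← Submodule.topologicalClosure_coe]
  by_contra hx
  have : IsClosed (M.topologicalClosure : Set X) := M.isClosed_topologicalClosure
  have hne : M.topologicalClosure.mkQL x ≠ 0 := by
    rw [Submodule.mkQL_apply, Submodule.mkQ_apply, Ne, Submodule.Quotient.mk_eq_zero]
    exact hx
  obtain ⟨f, hf⟩ := SeparatingDual.exists_ne_zero (R := ℂ) hne
  refine hf (h (f.comp M.topologicalClosure.mkQL) fun m hm => ?_)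
  have : M.topologicalClosure.mkQL m = 0 := by
    rw [Submodule.mkQL_apply, Submodule.mkQ_apply, Submodule.Quotient.mk_eq_zero]
    exact M.le_topologicalClosure hm
  rw [ContinuousLinearMap.comp_apply, this, map_zero]

section Compact

variable (K : Set ℂ)

/-- The function `s ↦ -s` on `K`. -/
def negVar : C(K, ℂ) := ⟨fun s => -(s : ℂ), by fun_prop⟩

variable [CompactSpace K]

theorem exp_smul_negVar_apply (z : ℂ) (s : K) :
    NormedSpace.exp (z • negVar K) s = Complex.exp (z * -(s : ℂ)) := by
  have h := NormedSpace.map_exp (ContinuousMap.evalAlgHom ℂ ℂ s)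
    (continuous_eval_const s) (z • negVar K)
  rw [Complex.exp_eq_exp_ℂ]
  exact h

/-- The restriction of an entire function to `K`. -/
def restrictEntire {g : ℂ → ℂ} (hg : Differentiable ℂ g) : C(K, ℂ) :=
  ⟨fun s => g s, hg.continuous.comp continuous_subtype_val⟩

/-- The Taylor series of `g` at 0 converges uniformly on the compact `K`. -/
theorem map_restrictEntire_eq_zero (L : C(K, ℂ) →L[ℂ] ℂ) (h : ∀ k : ℕ, L (negVar K ^ k) = 0)
    {g : ℂ → ℂ} (hg : Differentiable ℂ g) : L (restrictEntire K hg) = 0 := by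
  set p := cauchyPowerSeries g 0 ((1 : NNReal) : ℝ) with hp
  have hps : HasFPowerSeriesOnBall g p 0 ⊤ := hg.hasFPowerSeriesOnBall 0 one_pos
  obtain ⟨r, hr⟩ := (isCompact_iff_compactSpace.2 ‹_› : IsCompact K).isBounded.subset_ball (0 : ℂ)
  have hu := hps.tendstoUniformlyOn (r' := r.toNNReal) ENNReal.coe_lt_top
  let S : ℕ → C(K, ℂ) := fun n =>
    ∑ k ∈ Finset.range n, (p.coeff k * (-1) ^ k) • negVar K ^ k
  have hS : Tendsto S atTop (𝓝 (restrictEntire K hg)) := by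
    rw [ContinuousMap.tendsto_iff_tendstoUniformly]
    refine Metric.tendstoUniformly_iff.2 fun ε hε => ?_
    filter_upwards [Metric.tendstoUniformlyOn_iff.1 hu ε hε] with n hn s
    have hs : (s : ℂ) ∈ Metric.ball (0 : ℂ) r.toNNReal :=
      Metric.ball_subset_ball (Real.le_coe_toNNReal r) (hr s.2)
    have := hn s hs
    have e : S n s = p.partialSum n s := by
      simp only [S, ContinuousMap.coe_sum, Finset.sum_apply, ContinuousMap.smul_apply,
        ContinuousMap.pow_apply, negVar, ContinuousMap.coe_mk,
        FormalMultilinearSeries.partialSum, FormalMultilinearSeries.apply_eq_pow_smul_coeff,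
        smul_eq_mul]
      refine Finset.sum_congr rfl fun k _ => ?_
      rw [mul_assoc, ← mul_pow, neg_one_mul, neg_neg, mul_comm]
    rw [e]
    simpa [restrictEntire] using this
  have hL := (L.continuous.tendsto _).comp hS
  refine tendsto_nhds_unique hL ?_
  have : L ∘ S = fun _ => 0 := by
    funext n
    simp [S, h]
  rw [this]
  exact tendsto_const_nhds

end Compact

/-- Simultaneous approximation: an entire function is approximated uniformly on compact subsets of
`{s | s.re ≤ δ}` by Dirichlet polynomials with high frequencies and small `‖·‖_σ`, `σ > δ`. -/
theorem exists_dirichletPolynomial_approx {K : Set ℂ} (hK : IsCompact K) {δ σ : ℝ} (hσ : 0 ≤ σ)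
    (hδσ : δ < σ) (hKδ : ∀ s ∈ K, s.re ≤ δ) {g : ℂ → ℂ} (hg : Differentiable ℂ g) {N : ℕ}
    (hN : 1 ≤ N) {ε : ℝ} (hε : 0 < ε) :
    ∃ c : ℕ →₀ ℂ, (∀ n < N, c n = 0) ∧ (c.sum fun n a => ‖a‖ * (n : ℝ) ^ (-σ)) < ε ∧
      ∀ s ∈ K, ‖(c.sum fun n a => a * (n : ℂ) ^ (-s)) - g s‖ < ε := by
  have : CompactSpace K := isCompact_iff_compactSpace.1 hK
  let e : ℕ → C(K, ℂ) := fun n => NormedSpace.exp ((Real.log n : ℂ) • negVar K)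
  have he : ∀ n, 1 ≤ n → ∀ s : K, e n s = (n : ℂ) ^ (-(s : ℂ)) := by
    intro n hn s
    have hn0 : (n : ℂ) ≠ 0 := by exact_mod_cast (show n ≠ 0 by omega)
    rw [Complex.cpow_def_of_ne_zero hn0, ← Complex.natCast_log]
    exact exp_smul_negVar_apply K _ s
  -- The ℓ¹ coordinate records the cost ∑ |c_n| n^{-σ}, so approximating (0, g) asks for cheapness
  -- and closeness at once.
  let v : ℕ → lp (fun _ : ℕ => ℂ) 1 × C(K, ℂ) := fun n =>
    (lp.single 1 n (((n : ℝ) ^ (-σ) : ℝ) : ℂ), e n)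
  let M := Submodule.span ℂ (v '' Set.Ici N)
  have hmem : ((0 : lp (fun _ : ℕ => ℂ) 1), restrictEntire K hg) ∈ closure (M : Set _) := by
    refine mem_closure_of_forall_dual M _ fun f hf => ?_
    set L : C(K, ℂ) →L[ℂ] ℂ := f.comp (ContinuousLinearMap.inr ℂ _ _) with hL
    change L (restrictEntire K hg) = 0
    obtain ⟨R, hR0, hR⟩ := hK.isBounded.exists_pos_norm_le
    refine map_restrictEntire_eq_zero K L (map_pow_eq_zero_of_decay L (negVar K) (R := R) (δ := δ)
      (σ := σ) (C := ‖f‖) hσ hδσ hR0.le (norm_nonneg _) ?_ ?_ hN ?_) hg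
    · intro z
      refine (ContinuousMap.norm_le _ (Real.exp_pos _).le).2 fun s => ?_
      rw [exp_smul_negVar_apply, Complex.norm_exp, Real.exp_le_exp]
      refine (Complex.re_le_norm _).trans ?_
      rw [norm_mul, norm_neg, mul_comm]
      gcongr
      exact hR s s.2
    · intro t ht
      refine (ContinuousMap.norm_le _ (Real.exp_pos _).le).2 fun s => ?_
      rw [exp_smul_negVar_apply, Complex.norm_exp, Real.exp_le_exp, Complex.re_ofReal_mul,
        Complex.neg_re]
      nlinarith [hKδ s s.2]
    · intro n hn
      have h0 : f (v n) = 0 := hf _ (Submodule.subset_span ⟨n, hn, rfl⟩)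
      have h1 : v n = (lp.single 1 n (((n : ℝ) ^ (-σ) : ℝ) : ℂ), 0) + (0, e n) := by
        simp [v]
      rw [h1, map_add] at h0
      -- Annihilation of `v n` trades the C(K) part for the ℓ¹ part, of size at most ‖f‖ n^{-σ}.
      have h2 : L (e n) = -f (lp.single 1 n (((n : ℝ) ^ (-σ) : ℝ) : ℂ), 0) :=
        eq_neg_of_add_eq_zero_right h0
      change ‖L (e n)‖ ≤ _
      rw [h2, norm_neg]
      refine (f.le_opNorm _).trans ?_
      gcongr
      rw [Prod.norm_mk, norm_zero, lp.norm_single one_pos, Complex.norm_real,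
        Real.norm_of_nonneg (by positivity)]
      exact max_le le_rfl (by positivity)
  obtain ⟨m, hm, hdist⟩ := Metric.mem_closure_iff.1 hmem ε hε
  obtain ⟨c, hc, rfl⟩ := (Finsupp.mem_span_image_iff_linearCombination ℂ).1 hm
  have hcN : ∀ n < N, c n = 0 := fun n hn => by
    by_contra h
    exact absurd ((Finsupp.mem_supported ℂ c).1 hc (Finsupp.mem_support_iff.2 h)) (by simpa using hn)
  rw [dist_comm, dist_eq_norm, Prod.norm_def, max_lt_iff] at hdist
  have h1 : (Finsupp.linearCombination ℂ v c).1
      = c.sum fun n a => lp.single 1 n (a * (((n : ℝ) ^ (-σ) : ℝ) : ℂ)) := by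
    rw [Finsupp.linearCombination_apply, Finsupp.sum, Finsupp.sum, Prod.fst_sum]
    refine Finset.sum_congr rfl fun n _ => ?_
    rw [Prod.smul_fst, ← lp.single_smul, smul_eq_mul]
  have h2 : (Finsupp.linearCombination ℂ v c).2 = c.sum fun n a => a • e n := by
    rw [Finsupp.linearCombination_apply, Finsupp.sum, Finsupp.sum, Prod.snd_sum]
    rfl
  refine ⟨c, hcN, lt_of_le_of_lt ?_ hdist.1, fun s hs => lt_of_le_of_lt ?_ hdist.2⟩
  · set w := (Finsupp.linearCombination ℂ v c).1 with hw
    have hwn : ∀ n, w n = c n * (((n : ℝ) ^ (-σ) : ℝ) : ℂ) := by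
      intro n
      rw [h1, Finsupp.sum, lp.coeFn_sum, Finset.sum_apply]
      simp only [lp.single_apply]
      rw [Finset.sum_pi_single]
      split_ifs with h
      · rfl
      · rw [Finsupp.notMem_support_iff.1 h, zero_mul]
    have hs := lp.hasSum_norm (p := 1) (by simp) w
    simp only [ENNReal.toReal_one, Real.rpow_one] at hs
    have hle := sum_le_hasSum c.support (fun n _ => norm_nonneg _) hs
    rw [Prod.fst_sub, sub_zero]
    refine le_trans (le_of_eq ?_) hle
    refine Finset.sum_congr rfl fun n _ => ?_
    rw [hwn, norm_mul, Complex.norm_real, Real.norm_of_nonneg (by positivity)]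
  · have h3 := ContinuousMap.norm_coe_le_norm
      ((Finsupp.linearCombination ℂ v c - (0, restrictEntire K hg)).2) (⟨s, hs⟩ : K)
    refine le_trans (le_of_eq ?_) h3
    rw [Prod.snd_sub, h2, ContinuousMap.sub_apply, Finsupp.sum, Finsupp.sum,
      ContinuousMap.coe_sum, Finset.sum_apply]
    congr 2
    refine Finset.sum_congr rfl fun n hn => ?_
    have : 1 ≤ n := by
      by_contra h
      exact (Finsupp.mem_support_iff.1 hn) (hcN n (by omega))
    rw [ContinuousMap.smul_apply, he n this, smul_eq_mul]

/-! ### `Da` as a Polish space -/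

instance : IsTopologicalAddGroup Da := Da.withSeminorms.topologicalAddGroup

instance : ContinuousSMul ℂ Da := Da.withSeminorms.continuousSMul

theorem Da.coeff_zero_index (D : Da) : D.coeff 0 = 0 := D.2.1

theorem Da.coeff_sub (D E : Da) : (D - E).coeff = D.coeff - E.coeff := rfl

theorem Da.coeff_injective : Function.Injective Da.coeff := Subtype.val_injective

theorem Da.seminorm_apply (σ : {σ : ℝ // 0 < σ}) (D : Da) :
    Da.seminorm σ D = ∑' n : ℕ, ‖D.coeff n‖ * (n : ℝ) ^ (-(σ : ℝ)) := rfl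

theorem Da.norm_coeff_mul_rpow_anti (D : Da) {σ τ : ℝ} (h : σ ≤ τ) (n : ℕ) :
    ‖D.coeff n‖ * (n : ℝ) ^ (-τ) ≤ ‖D.coeff n‖ * (n : ℝ) ^ (-σ) := by
  rcases Nat.eq_zero_or_pos n with rfl | hn
  · simp [D.coeff_zero_index]
  · have : (1 : ℝ) ≤ n := by exact_mod_cast hn
    gcongr

theorem Da.seminorm_anti {σ τ : {σ : ℝ // 0 < σ}} (h : σ ≤ τ) :
    Da.seminorm τ ≤ Da.seminorm σ := fun D =>
  (D.summable τ.2).tsum_le_tsum (D.norm_coeff_mul_rpow_anti h) (D.summable σ.2)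

/-- Seminorms grow as σ decreases, so finitely many are dominated by one. -/
theorem Da.mem_nhds_iff {D : Da} {U : Set Da} :
    U ∈ 𝓝 D ↔ ∃ σ : {σ : ℝ // 0 < σ}, ∃ ε > 0, ∀ E, Da.seminorm σ (E - D) < ε → E ∈ U := by
  rw [Da.withSeminorms.mem_nhds_iff]
  constructor
  · rintro ⟨s, r, hr, h⟩
    obtain ⟨σ, hσ⟩ := s.bddBelow
    refine ⟨σ, r, hr, fun E hE => h ?_⟩
    rw [Seminorm.mem_ball]
    exact (Finset.sup_le (fun i hi => Da.seminorm_anti (hσ hi)) (E - D)).trans_lt hE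
  · rintro ⟨σ, ε, hε, h⟩
    refine ⟨{σ}, ε, hε, fun E hE => h E ?_⟩
    rwa [Finset.sup_singleton, Seminorm.mem_ball] at hE

/-- The `n`-th coefficient as a continuous linear functional. -/
def Da.coeffL (n : ℕ) : Da →L[ℂ] ℂ where
  toFun D := D.coeff n
  map_add' _ _ := rfl
  map_smul' _ _ := rfl
  cont := by
    refine continuous_iff_continuousAt.2 fun D => ?_
    refine Metric.tendsto_nhds.2 fun ε hε => Da.mem_nhds_iff.2 ?_
    -- The coefficient is at most `n` times the seminorm at σ = 1; the `+ 1` keeps the radius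
    -- positive at `n = 0`.
    refine ⟨⟨1, one_pos⟩, ε / (n + 1), by positivity, fun E hE => ?_⟩
    change dist (E.coeff n) (D.coeff n) < ε
    rw [dist_eq_norm, ← Pi.sub_apply, ← Da.coeff_sub]
    rcases Nat.eq_zero_or_pos n with rfl | hn
    · simpa [(E - D).coeff_zero_index] using hε
    have hn' : (0 : ℝ) < n := by exact_mod_cast hn
    have h1 := ((E - D).summable one_pos).le_tsum n (fun m _ => by positivity)
    have h2 := h1.trans_lt hE
    rw [Real.rpow_neg_one, ← div_eq_mul_inv, div_lt_div_iff₀ hn' (by positivity)] at h2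
    nlinarith [norm_nonneg ((E - D).coeff n)]

/-- The Dirichlet polynomial with the given coefficients. -/
def Da.ofFiniteSupport (a : ℕ → ℂ) (h0 : a 0 = 0) (ha : a.support.Finite) : Da :=
  ⟨a, h0, fun σ _ => summable_of_hasFiniteSupport
    (ha.subset fun n hn => by
      rw [Function.mem_support] at hn ⊢
      exact fun h => hn (by simp [h]))⟩

/-- The truncation of a Dirichlet series to the first `N` terms. -/
def Da.trunc (D : Da) (N : ℕ) : Da :=
  Da.ofFiniteSupport (fun n => if n ≤ N then D.coeff n else 0) (by simp [D.coeff_zero_index])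
    ((Set.finite_Iic N).subset fun n hn => by
      by_contra h
      exact hn (if_neg h))

theorem Da.coeff_trunc (D : Da) (N n : ℕ) :
    (D.trunc N).coeff n = if n ≤ N then D.coeff n else 0 := rfl

theorem Da.tendsto_trunc (D : Da) : Tendsto D.trunc atTop (𝓝 D) := by
  rw [Da.withSeminorms.tendsto_nhds]
  intro σ ε hε
  have hs := (D.summable σ.2).hasSum
  have h1 : ∀ N, Da.seminorm σ (D.trunc N - D) = Da.seminorm σ D
      - ∑ n ∈ Finset.range (N + 1), ‖D.coeff n‖ * (n : ℝ) ^ (-(σ : ℝ)) := by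
    intro N
    have h2 : HasSum (fun n => if n ≤ N then ‖D.coeff n‖ * (n : ℝ) ^ (-(σ : ℝ)) else 0)
        (∑ n ∈ Finset.range (N + 1), ‖D.coeff n‖ * (n : ℝ) ^ (-(σ : ℝ))) := by
      have h3 := hasSum_sum_of_ne_finset_zero (s := Finset.range (N + 1)) (L := .unconditional ℕ)
        (f := fun n => if n ≤ N then ‖D.coeff n‖ * (n : ℝ) ^ (-(σ : ℝ)) else 0)
        (fun n hn => if_neg fun h => hn (Finset.mem_range.2 (by omega)))
      rwa [Finset.sum_congr rfl fun n hn => if_pos (Nat.lt_succ_iff.1 (Finset.mem_range.1 hn))]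
        at h3
    refine Eq.trans (tsum_congr fun n => ?_) (hs.sub h2).tsum_eq
    rw [Da.coeff_sub, Pi.sub_apply, Da.coeff_trunc]
    split_ifs <;> simp
  have h2 := hs.tendsto_sum_nat.comp (tendsto_add_atTop_nat 1)
  filter_upwards [h2.eventually (lt_mem_nhds (sub_lt_self (Da.seminorm σ D) hε))] with N hN
  rw [h1]
  have : Da.seminorm σ D - ε
    < ∑ n ∈ Finset.range (N + 1), ‖D.coeff n‖ * (n : ℝ) ^ (-(σ : ℝ)) := hN
  linarith

/-- The monomial `n ^ (-s)`, for `n ≥ 1`, and `0` for `n = 0`. -/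
def Da.monomial (n : ℕ) : Da :=
  Da.ofFiniteSupport (fun m => if m = n ∧ m ≠ 0 then 1 else 0) (by simp)
    ((Set.finite_singleton n).subset fun m hm => by
      by_contra h
      exact hm (if_neg fun h' => h h'.1))

theorem Da.trunc_mem_span (D : Da) (N : ℕ) :
    D.trunc N ∈ Submodule.span ℂ (Set.range Da.monomial) := by
  have : D.trunc N = ∑ n ∈ Finset.range (N + 1), D.coeff n • Da.monomial n := by
    refine Da.coeff_injective (funext fun m => ?_)
    change _ = Da.coeffL m _
    rw [map_sum]
    simp only [map_smul, smul_eq_mul]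
    have : ∀ n, Da.coeffL m (Da.monomial n) = if m = n ∧ m ≠ 0 then 1 else 0 := fun n => rfl
    simp only [this, mul_ite, mul_one, mul_zero, Da.coeff_trunc, ite_and]
    rw [Finset.sum_ite_eq]
    simp only [Finset.mem_range, Nat.lt_succ_iff]
    rcases eq_or_ne m 0 with rfl | hm
    · simp [D.coeff_zero_index]
    · simp [hm]
  rw [this]
  exact Submodule.sum_mem _ fun n _ => Submodule.smul_mem _ _ (Submodule.subset_span ⟨n, rfl⟩)

instance : TopologicalSpace.SeparableSpace Da := by
  have h := (Set.countable_range Da.monomial).isSeparable.span (R := ℂ)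
  refine TopologicalSpace.isSeparable_univ_iff.1 (h.closure.mono fun D _ => ?_)
  exact mem_closure_of_tendsto D.tendsto_trunc (Eventually.of_forall D.trunc_mem_span)

/-- The weighted coefficient sequence `(a_n n ^ (-σ))`, an element of `ℓ¹`. -/
def Da.weighted (σ : {σ : ℝ // 0 < σ}) (D : Da) : lp (fun _ : ℕ => ℂ) 1 :=
  ⟨fun n => D.coeff n * (((n : ℝ) ^ (-(σ : ℝ)) : ℝ) : ℂ), memℓp_gen (by
    refine (D.summable σ.2).congr fun n => ?_
    rw [norm_mul, Complex.norm_real, Real.norm_of_nonneg (by positivity)]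
    simp)⟩

theorem Da.weighted_apply (σ : {σ : ℝ // 0 < σ}) (D : Da) (n : ℕ) :
    D.weighted σ n = D.coeff n * (((n : ℝ) ^ (-(σ : ℝ)) : ℝ) : ℂ) := rfl

theorem Da.norm_weighted_sub (σ : {σ : ℝ // 0 < σ}) (D E : Da) :
    ‖D.weighted σ - E.weighted σ‖ = Da.seminorm σ (D - E) := by
  rw [lp.norm_eq_tsum_rpow (by simp)]
  simp only [ENNReal.toReal_one, Real.rpow_one, div_one]
  refine tsum_congr fun n => ?_
  rw [lp.coeFn_sub, Pi.sub_apply, Da.weighted_apply, Da.weighted_apply, ← sub_mul, norm_mul,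
    Complex.norm_real, Real.norm_of_nonneg (by positivity)]
  rfl

/-- The exponents `1 / (k + 1)`. -/
def exponent (k : ℕ) : {σ : ℝ // 0 < σ} := ⟨1 / ((k : ℝ) + 1), by positivity⟩

theorem exists_exponent_le (σ : {σ : ℝ // 0 < σ}) : ∃ k, exponent k ≤ σ := by
  obtain ⟨k, hk⟩ := exists_nat_one_div_lt σ.2
  exact ⟨k, hk.le⟩

/-- The embedding of `D_a(ℂ₊)` into a countable product of copies of `ℓ¹`. -/
def Da.embedding (D : Da) : ℕ → lp (fun _ : ℕ => ℂ) 1 := fun k => D.weighted (exponent k)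

theorem Da.isInducing_embedding : IsInducing Da.embedding := by
  refine isInducing_iff_nhds.2 fun D => le_antisymm ?_ ?_
  · refine Tendsto.le_comap (tendsto_pi_nhds.2 fun k => Metric.tendsto_nhds.2 fun ε hε => ?_)
    refine Da.mem_nhds_iff.2 ⟨exponent k, ε, hε, fun E hE => ?_⟩
    change dist (E.weighted _) (D.weighted _) < ε
    rwa [dist_eq_norm, Da.norm_weighted_sub]
  · intro U hU
    obtain ⟨σ, ε, hε, h⟩ := Da.mem_nhds_iff.1 hU
    obtain ⟨k, hk⟩ := exists_exponent_le σ
    refine mem_comap.2 ⟨(fun y => y k) ⁻¹' Metric.ball (D.embedding k) ε,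
      (continuous_apply k).continuousAt.preimage_mem_nhds (Metric.ball_mem_nhds _ hε),
      fun E hE => h E ((Da.seminorm_anti hk _).trans_lt ?_)⟩
    rw [← Da.norm_weighted_sub, ← dist_eq_norm]
    exact hE

theorem mul_rpow_neg_mul_rpow {n : ℕ} (hn : n ≠ 0) (z : ℂ) (σ : ℝ) :
    z * (((n : ℝ) ^ (-σ) : ℝ) : ℂ) * (((n : ℝ) ^ σ : ℝ) : ℂ) = z := by
  have : (0 : ℝ) < n := by positivity
  rw [mul_assoc, ← Complex.ofReal_mul, ← Real.rpow_add this]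
  simp

theorem Da.injective_embedding : Function.Injective Da.embedding := by
  intro D E h
  refine Da.coeff_injective (funext fun n => ?_)
  rcases eq_or_ne n 0 with rfl | hn
  · rw [D.coeff_zero_index, E.coeff_zero_index]
  have h1 : D.weighted (exponent 0) n = E.weighted (exponent 0) n := by
    rw [show D.weighted (exponent 0) = E.weighted (exponent 0) from congrFun h 0]
  rw [Da.weighted_apply, Da.weighted_apply] at h1
  rw [← mul_rpow_neg_mul_rpow hn (D.coeff n) (exponent 0), h1, mul_rpow_neg_mul_rpow hn]

/-- Undoing the weights must give the same coefficients for every `k`. These conditions are closed,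
coordinates being continuous on ℓ¹. -/
theorem Da.range_embedding : Set.range Da.embedding =
    {y | ∀ k, y k 0 = 0 ∧ ∀ n : ℕ, n ≠ 0 → y k n * (((n : ℝ) ^ (exponent k : ℝ) : ℝ) : ℂ)
      = y 0 n * (((n : ℝ) ^ (exponent 0 : ℝ) : ℝ) : ℂ)} := by
  ext y
  constructor
  · rintro ⟨D, rfl⟩ k
    refine ⟨?_, fun n hn => ?_⟩
    · change D.weighted _ 0 = 0
      rw [Da.weighted_apply, D.coeff_zero_index, zero_mul]
    · change D.weighted _ n * _ = D.weighted _ n * _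
      rw [Da.weighted_apply, Da.weighted_apply, mul_rpow_neg_mul_rpow hn,
        mul_rpow_neg_mul_rpow hn]
  · intro hy
    obtain ⟨a, ha0, hay⟩ : ∃ a : ℕ → ℂ, a 0 = 0 ∧
        ∀ k n, a n * (((n : ℝ) ^ (-(exponent k : ℝ)) : ℝ) : ℂ) = y k n := by
      refine ⟨fun n => y 0 n * (((n : ℝ) ^ (exponent 0 : ℝ) : ℝ) : ℂ), by simp [(hy 0).1],
        fun k n => ?_⟩
      rcases eq_or_ne n 0 with rfl | hn
      · simp [(hy 0).1, (hy k).1]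
      · have h1 := mul_rpow_neg_mul_rpow hn (y k n) (-(exponent k : ℝ))
        rw [neg_neg] at h1
        rw [← h1, (hy k).2 n hn]
    have ha : ∀ σ : ℝ, 0 < σ → Summable fun n : ℕ => ‖a n‖ * (n : ℝ) ^ (-σ) := by
      intro σ hσ
      obtain ⟨k, hk⟩ := exists_exponent_le ⟨σ, hσ⟩
      have hs := (lp.memℓp (y k)).summable (by simp)
      simp only [ENNReal.toReal_one, Real.rpow_one] at hs
      refine Summable.of_nonneg_of_le (fun n => by positivity) (fun n => ?_) hs
      rw [← hay k n, norm_mul, Complex.norm_real, Real.norm_of_nonneg (by positivity)]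
      rcases Nat.eq_zero_or_pos n with rfl | hn
      · simp [ha0]
      · have : (1 : ℝ) ≤ n := by exact_mod_cast hn
        have hk' : (exponent k : ℝ) ≤ σ := hk
        gcongr
    exact ⟨⟨a, ha0, ha⟩, funext fun k => lp.ext (funext fun n => hay k n)⟩

theorem Da.isClosedEmbedding_embedding : IsClosedEmbedding Da.embedding := by
  refine ⟨⟨Da.isInducing_embedding, Da.injective_embedding⟩, ?_⟩
  have hc : ∀ k n : ℕ, Continuous fun y : ℕ → lp (fun _ : ℕ => ℂ) 1 => y k n := by
    intro k n
    have : Continuous fun x : lp (fun _ : ℕ => ℂ) 1 => x n :=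
      (continuous_apply n).comp (lp.uniformContinuous_coe (p := 1)).continuous
    exact this.comp (continuous_apply k)
  rw [Da.range_embedding]
  simp only [Set.ofPred_forall, Set.ofPred_and]
  refine isClosed_iInter fun k => (isClosed_eq (hc k 0) continuous_const).inter ?_
  exact isClosed_iInter fun n => isClosed_iInter fun _ =>
    isClosed_eq ((hc k n).mul continuous_const) ((hc 0 n).mul continuous_const)

instance : TopologicalSpace.IsCompletelyMetrizableSpace Da :=
  Da.isClosedEmbedding_embedding.IsCompletelyMetrizableSpace

instance : SecondCountableTopology Da := by
  let := TopologicalSpace.metrizableSpaceMetric Da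
  exact UniformSpace.secondCountable_of_separable Da

/-! ### Jets of entire functions and of partial sums -/

/-- An exhaustion of the closed left half-plane by compact sets. -/
def halfDisc (m : ℕ) : Set ℂ := Metric.closedBall 0 m ∩ {s | s.re ≤ 0}

theorem isCompact_halfDisc (m : ℕ) : IsCompact (halfDisc m) :=
  (isCompact_closedBall _ _).inter_right (isClosed_le Complex.continuous_re continuous_const)

instance (m : ℕ) : CompactSpace (halfDisc m) := isCompact_iff_compactSpace.1 (isCompact_halfDisc m)

/-- The space of entire functions. -/
def entire : Submodule ℂ (ℂ → ℂ) where
  carrier := {f | Differentiable ℂ f}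
  zero_mem' := differentiable_const 0
  add_mem' hf hg := Differentiable.add hf hg
  smul_mem' c _ hf := Differentiable.const_smul hf c

theorem entire.contDiff (f : entire) {n : WithTop ℕ∞} : ContDiff ℂ n (f : ℂ → ℂ) :=
  Differentiable.contDiff f.2

/-- The derivatives of all orders of an entire function, as continuous functions on all members of
the exhaustion of the closed left half-plane. -/
def jet : entire →ₗ[ℂ] ((l m : ℕ) → C(halfDisc m, ℂ)) where
  toFun f l m := ⟨fun s => iteratedDeriv l (f : ℂ → ℂ) s,
    ((entire.contDiff f).continuous_iteratedDeriv l le_rfl).comp continuous_subtype_val⟩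
  map_add' f g := by
    ext l m s
    exact iteratedDeriv_add (entire.contDiff f).contDiffAt (entire.contDiff g).contDiffAt
  map_smul' c f := by
    ext l m s
    exact iteratedDeriv_const_smul (entire.contDiff f).contDiffAt c

theorem tendsto_jet_iff {ι : Type*} {p : Filter ι} {f : ι → entire} {g : entire} :
    Tendsto (fun j => jet (f j)) p (𝓝 (jet g)) ↔
      ∀ (l : ℕ) (K : Set ℂ), IsCompact K → K ⊆ {s : ℂ | s.re ≤ 0} →
        TendstoUniformlyOn (fun j => iteratedDeriv l (f j : ℂ → ℂ)) (iteratedDeriv l (g : ℂ → ℂ)) p K := by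
  simp only [tendsto_pi_nhds, ContinuousMap.tendsto_iff_tendstoUniformly]
  constructor
  · intro h l K hK hK0
    obtain ⟨r, hr⟩ := hK.isBounded.subset_closedBall (0 : ℂ)
    obtain ⟨m, hm⟩ := exists_nat_ge r
    refine TendstoUniformlyOn.mono (s := halfDisc m) ?_
      fun s hs => ⟨Metric.closedBall_subset_closedBall hm (hr hs), hK0 hs⟩
    exact tendstoUniformlyOn_iff_tendstoUniformly_comp_coe.2 (h l m)
  · intro h l m
    exact tendstoUniformlyOn_iff_tendstoUniformly_comp_coe.1
      (h l _ (isCompact_halfDisc m) Set.inter_subset_right)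

theorem tendstoLocallyUniformlyOn_iteratedDeriv {ι : Type*} {p : Filter ι} {F : ι → ℂ → ℂ}
    {f : ℂ → ℂ} {U : Set ℂ} (hU : IsOpen U) (h : TendstoLocallyUniformlyOn F f p U)
    (hF : ∀ j, Differentiable ℂ (F j)) (l : ℕ) :
    TendstoLocallyUniformlyOn (fun j => iteratedDeriv l (F j)) (iteratedDeriv l f) p U := by
  induction l with
  | zero => simpa using h
  | succ l ih =>
    simp only [iteratedDeriv_succ]
    refine ih.deriv (Eventually.of_forall fun j => ?_) hU
    exact (Differentiable.differentiableOn
      (((hF j).contDiff (n := ⊤)).differentiable_iteratedDeriv l (by exact_mod_cast WithTop.coe_lt_top _)))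

/-- The open half-plane Re s < δ contains the closed left one, so locally uniform convergence there
carries over to all derivatives. -/
theorem tendsto_jet_of_approx {δ : ℝ} (hδ : 0 < δ) {f : ℕ → entire} {g : entire}
    (h : ∀ j : ℕ, ∀ s ∈ Metric.closedBall (0 : ℂ) j ∩ {s | s.re ≤ δ},
      ‖(f j : ℂ → ℂ) s - (g : ℂ → ℂ) s‖ < 1 / ((j : ℝ) + 1)) :
    Tendsto (fun j => jet (f j)) atTop (𝓝 (jet g)) := by
  have hU : IsOpen {s : ℂ | s.re < δ} := isOpen_lt Complex.continuous_re continuous_const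
  have hloc : TendstoLocallyUniformlyOn (fun j => (f j : ℂ → ℂ)) g atTop {s : ℂ | s.re < δ} := by
    refine (tendstoLocallyUniformlyOn_iff_forall_isCompact hU).2 fun K hKU hK => ?_
    obtain ⟨r, hr⟩ := hK.isBounded.subset_closedBall (0 : ℂ)
    refine Metric.tendstoUniformlyOn_iff.2 fun ε hε => ?_
    filter_upwards [eventually_ge_atTop ⌈r⌉₊,
      tendsto_one_div_add_atTop_nhds_zero_nat.eventually (gt_mem_nhds hε)] with j hj hjε s hs
    rw [dist_comm, dist_eq_norm]
    refine (h j s ⟨Metric.closedBall_subset_closedBall (Nat.ceil_le.1 hj) (hr hs), ?_⟩).trans hjε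
    exact (show s.re < δ from hKU hs).le
  refine tendsto_jet_iff.2 fun l K hK hK0 => ?_
  refine (tendstoLocallyUniformlyOn_iff_forall_isCompact hU).1
    (tendstoLocallyUniformlyOn_iteratedDeriv hU hloc (fun j => (f j).2) l) K (fun s hs => ?_) hK
  exact lt_of_le_of_lt (hK0 hs) hδ

/-- The function `s ↦ n ^ (-s)`. -/
def entireMonomial (n : ℕ) (hn : n ≠ 0) : entire :=
  ⟨fun s => (n : ℂ) ^ (-s), fun s =>
    (differentiableAt_id.neg).const_cpow (Or.inl (by exact_mod_cast hn))⟩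

theorem Da.differentiable_partialSum (D : Da) (N : ℕ) : Differentiable ℂ (D.partialSum N) := by
  refine Differentiable.fun_sum fun n hn => Differentiable.const_mul ?_ _
  exact (entireMonomial n (by have := Finset.mem_Icc.1 hn; omega)).2

/-- The partial sums as a linear map into the entire functions. -/
def Da.partialSumL (N : ℕ) : Da →ₗ[ℂ] entire where
  toFun D := ⟨D.partialSum N, D.differentiable_partialSum N⟩
  map_add' D E := by
    ext s
    simp [Da.partialSum, Da.coeff_add, add_mul, Finset.sum_add_distrib]
  map_smul' c D := by
    ext s
    simp [Da.partialSum, Da.coeff_smul, Finset.mul_sum, mul_assoc]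

/-- The jets of the partial sums. -/
def partialSumJet (N : ℕ) : Da →L[ℂ] ((l m : ℕ) → C(halfDisc m, ℂ)) where
  toLinearMap := jet ∘ₗ Da.partialSumL N
  cont := by
    -- A finite combination of fixed jets with continuous coefficients; `entire` needs no topology.
    have : ∀ D : Da, jet (Da.partialSumL N D) = ∑ n ∈ Finset.range N,
        D.coeff (n + 1) • jet (entireMonomial (n + 1) n.succ_ne_zero) := by
      intro D
      simp only [← map_smul, ← map_sum]
      congr 1
      ext s
      simp only [Submodule.coe_sum, Finset.sum_apply]
      change ∑ n ∈ Finset.Icc 1 N, D.coeff n * (n : ℂ) ^ (-s) = _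
      rw [← Finset.Ico_add_one_right_eq_Icc, Finset.sum_Ico_eq_sum_range]
      refine Finset.sum_congr rfl fun n _ => ?_
      rw [add_comm 1 n]
      rfl
    change Continuous fun D => jet (Da.partialSumL N D)
    simp only [this]
    exact continuous_finsetSum _ fun n _ => (Da.coeffL (n + 1)).continuous.smul continuous_const

/-- The target space is first countable, so cluster points are limits along strictly increasing
indices. -/
theorem Da.isUniversal_iff (D : Da) :
    D.IsUniversal ↔ D ∈ universalSet partialSumJet (LinearMap.range jet : Set _) := by
  constructor
  · rintro h _ ⟨g, rfl⟩
    obtain ⟨lam, hlam, h⟩ := h g g.2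
    have h1 : Tendsto (fun j => jet (Da.partialSumL (lam j) D)) atTop (𝓝 (jet g)) :=
      tendsto_jet_iff.2 h
    exact MapClusterPt.of_comp hlam.tendsto_atTop h1.mapClusterPt
  · intro h g hg
    obtain ⟨lam, hlam, h⟩ := (h (jet ⟨g, hg⟩) ⟨_, rfl⟩).tendsto_subseq
    refine ⟨lam, hlam, ?_⟩
    exact (tendsto_jet_iff (f := fun j => Da.partialSumL (lam j) D) (g := ⟨g, hg⟩)).1 h

theorem Da.partialSum_eq_of_coeff_eq_zero {D : Da} {M N : ℕ} (h : ∀ n, M < n → D.coeff n = 0)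
    (hMN : M ≤ N) : D.partialSum N = D.partialSum M := by
  funext s
  refine (Finset.sum_subset (Finset.Icc_subset_Icc_right hMN) fun n hn hn' => ?_).symm
  rw [h n, zero_mul]
  rw [Finset.mem_Icc] at hn hn'
  omega

/-! ### Density and conclusion -/

theorem dense_eventually_partialSumJet_mem (g : entire)
    (B : Set ((l m : ℕ) → C(halfDisc m, ℂ))) (hB : IsOpen B) (hg : jet g ∈ B) :
    Dense {D : Da | ∀ᶠ N in atTop, partialSumJet N D ∈ B} := by
  refine dense_iff_inter_open.2 fun U hU ⟨D₀, hD₀⟩ => ?_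
  obtain ⟨M, hM⟩ := (D₀.tendsto_trunc.eventually (hU.mem_nhds hD₀)).exists
  set D := D₀.trunc M with hD
  have hDM : ∀ n, M < n → D.coeff n = 0 := fun n hn => by
    rw [hD, Da.coeff_trunc, if_neg (by omega)]
  obtain ⟨σ, ε, hε, hσ⟩ := Da.mem_nhds_iff.1 (hU.mem_nhds hM)
  have hσ0 : (0 : ℝ) < σ := σ.2
  -- Frequencies above `M` leave `D` untouched, so the target is `g` minus `D`; δ = σ/2 keeps a
  -- strip right of the imaginary axis for the derivatives.
  have happrox := fun j : ℕ => exists_dirichletPolynomial_approx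
    (K := Metric.closedBall (0 : ℂ) j ∩ {s | s.re ≤ (σ : ℝ) / 2})
    ((isCompact_closedBall _ _).inter_right (isClosed_le Complex.continuous_re continuous_const))
    hσ0.le (half_lt_self hσ0) (fun s hs => hs.2) (g - Da.partialSumL M D).2
    (N := M + 1) (by omega) (ε := 1 / ((j : ℝ) + 1)) (by positivity)
  choose c hc0 hcσ hcK using happrox
  let P : ℕ → Da := fun j => Da.ofFiniteSupport (c j) (hc0 j 0 (by omega)) (c j).hasFiniteSupport
  have hPc : ∀ j, (P j).coeff = c j := fun j => rfl
  have hPσ : ∀ j, Da.seminorm σ (P j) < 1 / ((j : ℝ) + 1) := by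
    intro j
    refine lt_of_le_of_lt (le_of_eq ?_) (hcσ j)
    rw [Da.seminorm_apply, hPc]
    refine tsum_eq_sum fun n hn => ?_
    rw [Finsupp.notMem_support_iff.1 hn, norm_zero, zero_mul]
  -- Past this index neither `D` nor `P j` has terms, so the partial sums are constant.
  let S : ℕ → ℕ := fun j => max M ((c j).support.sup id)
  have hPS : ∀ j n, S j < n → (P j).coeff n = 0 := by
    intro j n hn
    by_contra h
    have h1 : n ≤ (c j).support.sup id :=
      Finset.le_sup (f := id) (Finsupp.mem_support_iff.2 h)
    have h2 : (c j).support.sup id ≤ S j := le_max_right _ _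
    omega
  have hPK : ∀ j s, (P j).partialSum (S j) s = (c j).sum fun n a => a * (n : ℂ) ^ (-s) := by
    intro j s
    refine (Finset.sum_subset (fun n hn => ?_) fun n _ hn => ?_).symm
    · refine Finset.mem_Icc.2 ⟨?_, not_lt.1 fun h => Finsupp.mem_support_iff.1 hn (hPS j n h)⟩
      by_contra h
      exact Finsupp.mem_support_iff.1 hn (hc0 j n (by omega))
    · rw [hPc, Finsupp.notMem_support_iff.1 hn, zero_mul]
  have hlim : Tendsto (fun j => jet (Da.partialSumL (S j) (D + P j))) atTop (𝓝 (jet g)) := by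
    refine tendsto_jet_of_approx (half_pos hσ0) fun j s hs => ?_
    refine lt_of_le_of_lt (le_of_eq ?_) (hcK j s hs)
    rw [map_add]
    change ‖D.partialSum (S j) s + (P j).partialSum (S j) s - (g : ℂ → ℂ) s‖
      = ‖_ - ((g : ℂ → ℂ) s - D.partialSum M s)‖
    rw [Da.partialSum_eq_of_coeff_eq_zero hDM (le_max_left _ _ : M ≤ S j), hPK]
    congr 1
    ring
  obtain ⟨j, hjB, hjε⟩ := ((hlim.eventually (hB.mem_nhds hg)).and
    (tendsto_one_div_add_atTop_nhds_zero_nat.eventually (gt_mem_nhds hε))).exists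
  refine ⟨D + P j, hσ _ ?_, ?_⟩
  · rw [add_sub_cancel_left]
    exact (hPσ j).trans hjε
  · have hev : ∀ N, S j ≤ N → partialSumJet N (D + P j) ∈ B := by
      intro N hN
      have h1 : Da.partialSumL N (D + P j) = Da.partialSumL (S j) (D + P j) := by
        refine Subtype.ext (Da.partialSum_eq_of_coeff_eq_zero (fun n hn => ?_) hN)
        rw [Da.coeff_add, Pi.add_apply, hPS j n hn,
          hDM n (lt_of_le_of_lt (le_max_left _ _) hn), add_zero]
      change jet (Da.partialSumL N (D + P j)) ∈ B
      rw [h1]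
      exact hjB
    exact (eventually_ge_atTop (S j)).mono hev

end DirichletSeries

end

theorem mainTheorem6 :
    (∃ D : DirichletSeries.Da, D.IsUniversal) ∧
    Dense {D : DirichletSeries.Da | D.IsUniversal} ∧
    IsGδ {D : DirichletSeries.Da | D.IsUniversal} ∧
    ∃ V : Submodule ℂ DirichletSeries.Da,
      Dense (V : Set DirichletSeries.Da) ∧
      ∀ D ∈ V, D ≠ 0 → D.IsUniversal := by
  have hT : ∀ g ∈ LinearMap.range DirichletSeries.jet, ∀ B, IsOpen B → g ∈ B →
      Dense {D | ∀ᶠ N in atTop, DirichletSeries.partialSumJet N D ∈ B} := by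
    rintro _ ⟨g, rfl⟩ B hB hg
    exact DirichletSeries.dense_eventually_partialSumJet_mem g B hB hg
  have hset : {D : DirichletSeries.Da | D.IsUniversal} = DirichletSeries.universalSet
      DirichletSeries.partialSumJet (LinearMap.range DirichletSeries.jet : Set _) :=
    Set.ext DirichletSeries.Da.isUniversal_iff
  have hdense : Dense {D : DirichletSeries.Da | D.IsUniversal} :=
    hset ▸ DirichletSeries.dense_universalSet hT
  refine ⟨hdense.nonempty, hdense, hset ▸ DirichletSeries.isGδ_universalSet _ _, ?_⟩
  obtain ⟨V, hV, h⟩ := DirichletSeries.exists_dense_submodule_universalSet hT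
  exact ⟨V, hV, fun D hD hD0 => D.isUniversal_iff.2 (h D hD hD0)⟩
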